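/- Fix $\kappa>0$. The Degasperis–Procesi equation is $m_t+2\kappa u_x+3mu_x+um_x=0$ with $m=u-u_{xx}$. For $c>2\kappa$, a smooth solitary wave of speed $c$ is a solution $u(t,x)=\phi(x-ct)$ whose profile $\phi\in C^\infty(\mathbb{R})$ is real-valued, not identically zero and tends to $0$ at $\pm\infty$. Put $$H(u)=-\frac16\int_{\mathbb{R}}\Big(u^3+6\kappa\big((4-\partial_x^2)^{-1/2}u\big)^2\Big)\,dx,\qquad S(u)=\frac12\int_{\mathbb{R}}u\cdot(1-\partial_x^2)(4-\partial_x^2)^{-1}u\,dx,$$ where the operators are the Fourier multipliers on $L^2(\mathbb{R})$. For every $c>2\kappa$ let $\phi_c$ be the profile of a smooth solitary wave of speed $c$ (any translate may be chosen). Then for every $c>2\kappa$, $\phi_c\in L^2(\mathbb{R})\cap L^3(\mathbb{R})$, the functions $c\mapsto H(\phi_c)$ and $c\mapsto S(\phi_c)$ are differentiable, and $$\frac{d}{dc}H(\phi_c)=-c\,\frac{d}{dc}S(\phi_c)=-\frac{3c^2(c+\kappa)}{(3c+2\kappa)^2}\sqrt{c^2-2c\kappa}<0 .$$ -/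

import Mathlib

open Real Set Filter Topology MeasureTheory
open scoped ENNReal ContDiff FourierTransform

noncomputable section

namespace DegasperisProcesi

/-- The momentum density `m = u - u_xx` of a function `u` of time `t` and position `x`. -/
def momentumDensity (u : ℝ → ℝ → ℝ) (t x : ℝ) : ℝ :=
  u t x - iteratedDeriv 2 (u t) x

/-- `u` satisfies the Degasperis-Procesi equation `m_t + 2 κ u_x + 3 m u_x + u m_x = 0`
pointwise for all `t > 0` and `x ∈ ℝ`. (It is used only for smooth `u`.) -/
def SolvesDP (κ : ℝ) (u : ℝ → ℝ → ℝ) : Prop :=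
  ∀ t > 0, ∀ x : ℝ,
    deriv (fun s => momentumDensity u s x) t + 2 * κ * deriv (u t) x
      + 3 * momentumDensity u t x * deriv (u t) x
      + u t x * deriv (momentumDensity u t) x = 0

/-- `φ` is the profile of a smooth solitary wave of speed `c`: it is smooth, not identically
zero, it vanishes at `± ∞`, and `u(t, x) = φ(x - c t)` solves the Degasperis-Procesi equation. -/
structure IsSmoothSolitaryWave (κ c : ℝ) (φ : ℝ → ℝ) : Prop where
  smooth : ContDiff ℝ ∞ φ
  nontrivial : ∃ x, φ x ≠ 0
  decay : Tendsto φ (cocompact ℝ) (𝓝 0)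
  solves : SolvesDP κ (fun t x => φ (x - c * t))

/-- The space `L²(ℝ; ℂ)`. -/
abbrev L2 : Type := Lp ℂ 2 (volume : Measure ℝ)

/-- A real function as an element of `L²(ℝ; ℂ)` (and `0` if it is not square integrable). -/
def toL2 (u : ℝ → ℝ) : L2 :=
  open scoped Classical in
  if h : MemLp (fun x => (u x : ℂ)) 2 (volume : Measure ℝ) then h.toLp _ else 0

/-- The Fourier multiplier on `L²(ℝ; ℂ)` with bounded symbol `m`. -/
def multiplier (m : Lp ℂ ∞ (volume : Measure ℝ)) (f : L2) : L2 :=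
  𝓕⁻ ((m • 𝓕 f : L2))

/-- The symbol of `a - ∂_x²`, for the Fourier transform
`𝓕 f (ξ) = ∫ f(x) exp(-2 π i x ξ) dx`. -/
def symbol (a ξ : ℝ) : ℝ := a + (2 * π * ξ) ^ 2

theorem memLp_symbol_four_rpow :
    MemLp (fun ξ : ℝ => ((symbol 4 ξ ^ (-(1 / 2) : ℝ) : ℝ) : ℂ)) ∞ (volume : Measure ℝ) := by
  have h4 : ∀ ξ : ℝ, 1 ≤ symbol 4 ξ := fun ξ => by
    unfold symbol; nlinarith [sq_nonneg (2 * π * ξ)]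
  refine memLp_top_of_bound (Measurable.aestronglyMeasurable ?_) 1 (ae_of_all _ fun ξ => ?_)
  · unfold symbol; fun_prop
  · have h0 : 0 ≤ symbol 4 ξ ^ (-(1 / 2) : ℝ) := rpow_nonneg (by linarith [h4 ξ]) _
    rw [Complex.norm_real, Real.norm_of_nonneg h0]
    exact rpow_le_one_of_one_le_of_nonpos (h4 ξ) (by norm_num)

theorem memLp_symbol_one_div_four :
    MemLp (fun ξ : ℝ => ((symbol 1 ξ / symbol 4 ξ : ℝ) : ℂ)) ∞ (volume : Measure ℝ) := by
  refine memLp_top_of_bound (Measurable.aestronglyMeasurable ?_) 1 (ae_of_all _ fun ξ => ?_)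
  · unfold symbol; fun_prop
  · have h1 : 0 < symbol 1 ξ := by unfold symbol; positivity
    have h4 : 0 < symbol 4 ξ := by unfold symbol; positivity
    rw [Complex.norm_real, Real.norm_of_nonneg (by positivity), div_le_one h4]
    unfold symbol; linarith

/-- The operator `(4 - ∂_x²)^(-1/2)` on `L²`. -/
def invSqrtOp : L2 → L2 := multiplier (memLp_symbol_four_rpow.toLp _)

/-- The operator `(1 - ∂_x²)(4 - ∂_x²)⁻¹` on `L²`. -/
def momentumOp : L2 → L2 := multiplier (memLp_symbol_one_div_four.toLp _)

/-- The Hamiltonian `H(u) = -1/6 ∫ (u³ + 6 κ ((4 - ∂_x²)^(-1/2) u)²) dx`. Since the operator has a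
real even symbol, it maps real functions to real functions, so taking the real part loses
nothing. -/
def H (κ : ℝ) (u : ℝ → ℝ) : ℝ :=
  -(1 / 6) * ∫ x : ℝ, (u x ^ 3 + 6 * κ * (invSqrtOp (toL2 u) x).re ^ 2)

/-- The conserved quantity `S(u) = 1/2 ∫ u · (1 - ∂_x²)(4 - ∂_x²)⁻¹ u dx`. -/
def S (u : ℝ → ℝ) : ℝ :=
  (1 / 2) * ∫ x : ℝ, u x * (momentumOp (toL2 u) x).re

end DegasperisProcesi

end

noncomputable section

namespace DegasperisProcesi

open SchwartzMap Laplacian ComplexConjugate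

/-! The profile equation can be integrated until `H` and `S` become explicit functions of the speed,
and these are then differentiated. No smooth dependence of the profile on `c` is needed, and the
choice of translate is irrelevant.

Put p = c - 2κ/3, d = 2κ(3c + 2κ)/9 and s = √(c² - 2cκ). Two integrations (`second_order`,
`first_order`) give φ'² = φ²((φ - p)² - d)/(c - φ)². With r = (c - φ)φ'/φ, the pair (φ, r) moves on
the hyperbola r² = (φ - p)² - d. Its angle θ satisfies θ' = φ/(c - φ), so φ² and φ³ have primitives
polynomial in θ, r and φ (`hasDerivAt_primitive_sq`, `hasDerivAt_primitive_cube`). The limits r → ∓s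
at ±∞ then give ∫φ² and ∫φ³.

The nonlocal terms are explicit too: w = (cφ - φ²/2)/(3c + 2κ) solves 4w - w'' = φ, hence w = (4 -
∂_x²)⁻¹φ (`inv_symbol_smul_fourier_eq`). So `H` and `S` are combinations of ∫φ² and ∫φ³
(`memLp_and_energies`). -/

theorem symbol_four_pos (ξ : ℝ) : 0 < symbol 4 ξ := by unfold symbol; positivity

/-! ### Inverting 4 - ∂_x² on L² through tempered distributions -/

theorem hasTemperateGrowth_symbol_four_rpow (r : ℝ) :
    Function.HasTemperateGrowth (fun ξ : ℝ => ((symbol 4 ξ ^ r : ℝ) : ℂ)) := by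
  have h1 : Function.HasTemperateGrowth (fun ξ : ℝ => π * ξ) := by fun_prop
  have h2 : Function.HasTemperateGrowth
      (fun ξ : ℝ => (((4 : ℝ) ^ r * (1 + ‖π * ξ‖ ^ 2) ^ r : ℝ) : ℂ)) := by
    have h3 := (Function.hasTemperateGrowth_one_add_norm_sq_rpow ℝ r).comp h1
    have h4 : Function.HasTemperateGrowth
      (fun ξ : ℝ => (4 : ℝ) ^ r * (1 + ‖π * ξ‖ ^ 2) ^ r) :=
      (Function.HasTemperateGrowth.const _).mul h3
    fun_prop
  convert h2 using 3 with ξ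
  rw [← mul_rpow (by norm_num) (by positivity)]
  congr 1
  rw [Real.norm_eq_abs, sq_abs]; unfold symbol; ring

theorem memLp_inv_symbol_four :
    MemLp (fun ξ : ℝ => ((symbol 4 ξ ^ (-1 : ℝ) : ℝ) : ℂ)) ∞ (volume : Measure ℝ) := by
  refine memLp_top_of_bound
    (hasTemperateGrowth_symbol_four_rpow _).1.continuous.aestronglyMeasurable 1
    (ae_of_all _ fun ξ => ?_)
  rw [Complex.norm_real, Real.norm_of_nonneg (rpow_nonneg (symbol_four_pos ξ).le _)]
  refine rpow_le_one_of_one_le_of_nonpos ?_ (by norm_num)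
  unfold symbol; nlinarith [sq_nonneg (2 * π * ξ)]

theorem integral_deriv_mul_eq_neg {w w' : ℝ → ℂ} (hw : ∀ x, HasDerivAt w (w' x) x)
    (h0 : MemLp w 2 volume) (h1 : MemLp w' 2 volume) (u : 𝓢(ℝ, ℂ)) :
    ∫ x, derivCLM ℂ ℂ u x * w x = -∫ x, u x * w' x := by
  have hu : MemLp (u : ℝ → ℂ) 2 volume := u.memLp 2
  have hu' : MemLp (derivCLM ℂ ℂ u : ℝ → ℂ) 2 volume := (derivCLM ℂ ℂ u).memLp 2
  have := integral_mul_deriv_eq_deriv_mul_of_integrable (u := u) (v := w)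
    (u' := derivCLM ℂ ℂ u) (v' := w') (fun x _ => by
      simpa using u.differentiableAt.hasDerivAt) (fun x _ => hw x)
    (hu.integrable_mul h1) (hu'.integrable_mul h0) (hu.integrable_mul h0)
  rw [this, neg_neg]

theorem laplacian_eq_derivCLM_derivCLM (u : 𝓢(ℝ, ℂ)) :
    Δ u = derivCLM ℂ ℂ (derivCLM ℂ ℂ u) := by
  ext x
  rw [laplacian_apply, InnerProductSpace.laplacian_eq_iteratedDeriv_real, iteratedDeriv_succ,
    iteratedDeriv_one, derivCLM_apply]
  congr 1

theorem Lp_eq_of_toTemperedDistribution_apply_eq {f g : L2}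
    (h : ∀ u : 𝓢(ℝ, ℂ), Lp.toTemperedDistribution f u = Lp.toTemperedDistribution g u) :
    f = g := by
  have := Lp.ker_toTemperedDistributionCLM_eq_bot (F := ℂ) (μ := (volume : Measure ℝ)) (p := 2)
  refine LinearMap.ker_eq_bot.mp this ?_
  ext u
  exact h u

theorem toL2_of_memLp {u : ℝ → ℝ} (h : MemLp (fun x => (u x : ℂ)) 2 volume) :
    toL2 u = h.toLp _ := dif_pos h

theorem toTemperedDistribution_toL2_apply {u : ℝ → ℝ}
    (h : MemLp (fun x => (u x : ℂ)) 2 volume) (v : 𝓢(ℝ, ℂ)) :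
    Lp.toTemperedDistribution (toL2 u) v = ∫ x, v x * u x := by
  rw [toL2_of_memLp h, Lp.toTemperedDistribution_apply]
  refine integral_congr_ae ?_
  filter_upwards [h.coeFn_toLp] with x hx
  rw [hx, smul_eq_mul]

/-- If `4 w - w'' = f` with `w, w', w'' ∈ L²`, then `w = (4 - ∂_x²)⁻¹ f`. -/
theorem inv_symbol_smul_fourier_eq {f w w' w'' : ℝ → ℝ} (hw : ∀ x, HasDerivAt w (w' x) x)
    (hw' : ∀ x, HasDerivAt w' (w'' x) x) (hf : ∀ x, f x = 4 * w x - w'' x)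
    (h0 : MemLp (fun x => (w x : ℂ)) 2 volume) (h1 : MemLp (fun x => (w' x : ℂ)) 2 volume)
    (h2 : MemLp (fun x => (w'' x : ℂ)) 2 volume) (h3 : MemLp (fun x => (f x : ℂ)) 2 volume) :
    (memLp_inv_symbol_four.toLp _ • 𝓕 (toL2 f) : L2) = 𝓕 (toL2 w) := by
  -- Weak form of 4w - w'' = f: both derivatives are moved onto the test function.
  have key : ∀ v : 𝓢(ℝ, ℂ), Lp.toTemperedDistribution (toL2 f) v =
      Lp.toTemperedDistribution (toL2 w) ((4 : ℂ) • v - Δ v) := by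
    intro v
    rw [map_sub, map_smul, toTemperedDistribution_toL2_apply h3,
      toTemperedDistribution_toL2_apply h0, toTemperedDistribution_toL2_apply h0,
      laplacian_eq_derivCLM_derivCLM,
      integral_deriv_mul_eq_neg (fun x => (hw x).ofReal_comp) h0 h1,
      integral_deriv_mul_eq_neg (fun x => (hw' x).ofReal_comp) h1 h2, neg_neg, smul_eq_mul,
      ← integral_const_mul, ← integral_sub]
    · congr 1; ext x; rw [hf]; push_cast; ring
    · exact ((v.memLp 2).integrable_mul h0).const_mul _
    · exact (v.memLp 2).integrable_mul h2
  have key2 : Lp.toTemperedDistribution (toL2 f) =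
      (4 : ℂ) • Lp.toTemperedDistribution (toL2 w) - Δ (Lp.toTemperedDistribution (toL2 w)) := by
    ext v
    rw [key v, map_sub, map_smul]
    simp
  refine Lp_eq_of_toTemperedDistribution_apply_eq fun u => ?_
  rw [Lp.toTemperedDistribution_smul_eq (hasTemperateGrowth_symbol_four_rpow (-1))
    memLp_inv_symbol_four, TemperedDistribution.smulLeftCLM_apply_apply,
    ← Lp.fourier_toTemperedDistribution_eq, key2,
    TemperedDistribution.laplacian_eq_fourierMultiplierCLM,
    TemperedDistribution.fourierMultiplierCLM_apply, ← Lp.fourier_toTemperedDistribution_eq]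
  set W := 𝓕 (Lp.toTemperedDistribution (toL2 w))
  set v := SchwartzMap.smulLeftCLM ℂ (fun ξ : ℝ => ((symbol 4 ξ ^ (-1 : ℝ) : ℝ) : ℂ)) u
  have hq : Function.HasTemperateGrowth (fun x : ℝ => ((‖x‖ ^ 2 : ℝ) : ℂ)) := by fun_prop
  -- Since v is u divided by the symbol, multiplying v by the symbol 4 + (2πξ)² recovers u; this
  -- turns division on the side of f into the identity on the side of w.
  have hu : u = (4 : ℂ) • v +
      ((2 * π) ^ 2 : ℝ) • SchwartzMap.smulLeftCLM ℂ (fun x : ℝ => ((‖x‖ ^ 2 : ℝ) : ℂ)) v := by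
    ext ξ
    have h4 : (symbol 4 ξ : ℝ) ≠ 0 := (symbol_four_pos ξ).ne'
    have h5 : 4 * (symbol 4 ξ ^ (-1 : ℝ)) + (2 * π) ^ 2 * (‖ξ‖ ^ 2 * symbol 4 ξ ^ (-1 : ℝ)) = 1 := by
      rw [rpow_neg_one, Real.norm_eq_abs, sq_abs]
      field_simp
      unfold symbol; ring
    have h6 := congrArg (fun r : ℝ => (r : ℂ) * u ξ) h5
    simp only [Complex.ofReal_one, one_mul] at h6
    refine h6.symm.trans ?_
    rw [add_apply, smul_apply, smul_apply, SchwartzMap.smulLeftCLM_apply_apply hq,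
      SchwartzMap.smulLeftCLM_apply_apply (hasTemperateGrowth_symbol_four_rpow _)]
    simp only [smul_eq_mul, Complex.real_smul]
    push_cast
    ring
  have e1 : 𝓕 ((4 : ℂ) • Lp.toTemperedDistribution (toL2 w) - -(2 * π) ^ 2 •
      𝓕⁻ (TemperedDistribution.smulLeftCLM ℂ (fun x : ℝ => ((‖x‖ ^ 2 : ℝ) : ℂ)) W)) v = 
      W ((4 : ℂ) • v +
      ((2 * π) ^ 2 : ℝ) • SchwartzMap.smulLeftCLM ℂ (fun x : ℝ => ((‖x‖ ^ 2 : ℝ) : ℂ)) v) := by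
    have e2 : ∀ X : 𝓢'(ℝ, ℂ), -(-(2 * π) ^ 2 • X) = (((2 * π) ^ 2 : ℝ) : ℂ) • X := fun X => by
      ext z
      simp
    rw [sub_eq_add_neg, e2, FourierTransform.fourier_add, FourierTransform.fourier_smul,
      FourierTransform.fourier_smul, FourierTransform.fourier_fourierInv_eq, map_add, map_smul,
      ← Complex.coe_smul, map_smul]
    rfl
  rw [hu]
  exact e1

/-! ### Reality of the multipliers and their quadratic forms -/

/-- The complex conjugate of a Schwartz function. -/
def conjSchwartz (u : 𝓢(ℝ, ℂ)) : 𝓢(ℝ, ℂ) :=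
  u.postcompCLM (𝕜 := ℝ) (Complex.conjCLE : ℂ →L[ℝ] ℂ)

theorem conjSchwartz_apply (u : 𝓢(ℝ, ℂ)) (x : ℝ) : conjSchwartz u x = conj (u x) := by
  simp [conjSchwartz]

theorem fourier_conj_comp_neg (h : ℝ → ℂ) (x : ℝ) :
    𝓕 (fun ξ => conj (h (-ξ))) x = conj (𝓕 h x) := by
  rw [Real.fourier_real_eq_integral_exp_smul, Real.fourier_real_eq_integral_exp_smul,
    ← integral_conj, ← integral_neg_eq_self]
  refine integral_congr_ae (ae_of_all _ fun ξ => ?_)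
  simp only [smul_eq_mul, map_mul, neg_neg, ← Complex.exp_conj, Complex.conj_I,
    Complex.conj_ofReal]
  congr 2
  push_cast
  ring

theorem fourierInv_conj (h : ℝ → ℂ) (x : ℝ) :
    𝓕⁻ (fun ξ => conj (h ξ)) x = conj (𝓕⁻ h (-x)) := by
  rw [Real.fourierInv_eq_fourier_neg, Real.fourierInv_eq_fourier_neg, neg_neg,
    ← fourier_conj_comp_neg, Real.fourier_real_eq_integral_exp_smul,
    Real.fourier_real_eq_integral_exp_smul, ← integral_neg_eq_self]
  refine integral_congr_ae (ae_of_all _ fun ξ => ?_)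
  simp

/-- A Fourier multiplier with a real even symbol commutes with complex conjugation. -/
theorem fourier_smulLeft_fourierInv_conjSchwartz {m : ℝ → ℝ}
    (hm : Function.HasTemperateGrowth (fun ξ => (m ξ : ℂ))) (heven : ∀ ξ, m (-ξ) = m ξ)
    (u : 𝓢(ℝ, ℂ)) (x : ℝ) :
    𝓕 (smulLeftCLM ℂ (fun ξ => (m ξ : ℂ)) (𝓕⁻ (conjSchwartz u))) x =
      conj (𝓕 (smulLeftCLM ℂ (fun ξ => (m ξ : ℂ)) (𝓕⁻ u)) x) := by
  rw [fourier_coe, fourier_coe, ← fourier_conj_comp_neg]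
  refine congrFun (congrArg (fun h : ℝ → ℂ => 𝓕 h) (funext fun ξ => ?_)) x
  have : (conjSchwartz u : ℝ → ℂ) = fun x => conj (u x) := funext (conjSchwartz_apply u)
  rw [smulLeftCLM_apply_apply hm, smulLeftCLM_apply_apply hm, fourierInv_coe, fourierInv_coe,
    this, fourierInv_conj, heven, smul_eq_mul, smul_eq_mul, map_mul, Complex.conj_ofReal]

theorem toTemperedDistribution_multiplier_apply {m : ℝ → ℝ}
    (hm : Function.HasTemperateGrowth (fun ξ => (m ξ : ℂ)))
    (hmem : MemLp (fun ξ => (m ξ : ℂ)) ∞ (volume : Measure ℝ)) (f : L2) (u : 𝓢(ℝ, ℂ)) :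
    Lp.toTemperedDistribution (multiplier (hmem.toLp _) f) u =
      Lp.toTemperedDistribution f (𝓕 (smulLeftCLM ℂ (fun ξ => (m ξ : ℂ)) (𝓕⁻ u))) := by
  rw [multiplier, ← Lp.fourierInv_toTemperedDistribution_eq,
    TemperedDistribution.fourierInv_apply, Lp.toTemperedDistribution_smul_eq hm hmem,
    TemperedDistribution.smulLeftCLM_apply_apply, ← Lp.fourier_toTemperedDistribution_eq,
    TemperedDistribution.fourier_apply]

theorem toTemperedDistribution_star_apply (f : L2) (u : 𝓢(ℝ, ℂ)) :
    Lp.toTemperedDistribution (star f) u =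
      conj (Lp.toTemperedDistribution f (conjSchwartz u)) := by
  rw [Lp.toTemperedDistribution_apply, Lp.toTemperedDistribution_apply, ← integral_conj]
  refine integral_congr_ae ?_
  filter_upwards [Lp.coeFn_star f] with x hx
  rw [hx, conjSchwartz_apply]
  simp

/-- A Fourier multiplier with a real even symbol maps real functions to real functions. -/
theorem star_multiplier_eq {m : ℝ → ℝ}
    (hm : Function.HasTemperateGrowth (fun ξ => (m ξ : ℂ)))
    (hmem : MemLp (fun ξ => (m ξ : ℂ)) ∞ (volume : Measure ℝ)) (heven : ∀ ξ, m (-ξ) = m ξ)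
    {f : L2} (hf : star f = f) :
    star (multiplier (hmem.toLp _) f) = multiplier (hmem.toLp _) f := by
  refine Lp_eq_of_toTemperedDistribution_apply_eq fun u => ?_
  have h : 𝓕 (smulLeftCLM ℂ (fun ξ => (m ξ : ℂ)) (𝓕⁻ (conjSchwartz u))) =
      conjSchwartz (𝓕 (smulLeftCLM ℂ (fun ξ => (m ξ : ℂ)) (𝓕⁻ u))) := by
    ext x
    rw [conjSchwartz_apply, fourier_smulLeft_fourierInv_conjSchwartz hm heven]
  rw [toTemperedDistribution_star_apply, toTemperedDistribution_multiplier_apply hm,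
    toTemperedDistribution_multiplier_apply hm, h, ← toTemperedDistribution_star_apply, hf]

theorem star_toL2 {u : ℝ → ℝ} (h : MemLp (fun x => (u x : ℂ)) 2 volume) :
    star (toL2 u) = toL2 u := by
  rw [toL2_of_memLp h]
  refine Lp.ext ?_
  filter_upwards [Lp.coeFn_star (h.toLp _), h.coeFn_toLp] with x h1 h2
  rw [h1, Pi.star_apply, h2]
  simp

theorem coeFn_toL2 {u : ℝ → ℝ} (h : MemLp (fun x => (u x : ℂ)) 2 volume) :
    toL2 u =ᵐ[volume] fun x => (u x : ℂ) := by
  rw [toL2_of_memLp h]; exact h.coeFn_toLp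

theorem inner_toL2 {f g : ℝ → ℝ} (hf : MemLp (fun x => (f x : ℂ)) 2 volume)
    (hg : MemLp (fun x => (g x : ℂ)) 2 volume) :
    inner ℂ (toL2 f) (toL2 g) = ((∫ x, f x * g x : ℝ) : ℂ) := by
  rw [L2.inner_def, ← integral_complex_ofReal]
  refine integral_congr_ae ?_
  filter_upwards [coeFn_toL2 hf, coeFn_toL2 hg] with x h1 h2
  rw [h1, h2]
  simp [mul_comm]

/-- `‖(4 - ∂_x²)^(-1/2) f‖² = ⟪f, (4 - ∂_x²)⁻¹ f⟫`. -/
theorem norm_invSqrtOp_sq (f : L2) :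
    ((‖invSqrtOp f‖ ^ 2 : ℝ) : ℂ) =
      inner ℂ (𝓕 f) (memLp_inv_symbol_four.toLp _ • 𝓕 f : L2) := by
  have h1 : ‖invSqrtOp f‖ = ‖(memLp_symbol_four_rpow.toLp _ • 𝓕 f : L2)‖ := by
    rw [← Lp.norm_fourier_eq (invSqrtOp f), invSqrtOp, multiplier,
      FourierTransform.fourier_fourierInv_eq]
  have h2 := inner_self_eq_norm_sq_to_K (𝕜 := ℂ) (memLp_symbol_four_rpow.toLp _ • 𝓕 f : L2)
  rw [h1, Complex.ofReal_pow]
  refine h2.symm.trans ?_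
  rw [L2.inner_def, L2.inner_def]
  refine integral_congr_ae ?_
  filter_upwards [Lp.coeFn_lpSMul (r := 2) (memLp_symbol_four_rpow.toLp _) (𝓕 f),
    Lp.coeFn_lpSMul (r := 2) (memLp_inv_symbol_four.toLp _) (𝓕 f),
    memLp_symbol_four_rpow.coeFn_toLp, memLp_inv_symbol_four.coeFn_toLp] with ξ e1 e2 e3 e4
  rw [e1, e2, Pi.smul_apply', Pi.smul_apply', e3, e4, smul_eq_mul, smul_eq_mul]
  have h5 : symbol 4 ξ ^ (-1 : ℝ) = symbol 4 ξ ^ (-(1 / 2) : ℝ) * symbol 4 ξ ^ (-(1 / 2) : ℝ) := by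
    rw [← rpow_add (symbol_four_pos ξ)]; norm_num
  rw [h5]
  simp only [RCLike.inner_apply, map_mul, Complex.conj_ofReal]
  push_cast
  ring

/-- Because the multiplier preserves real functions, the squared real part is the full squared
modulus, and Plancherel turns its integral into the pairing of f with (4 - ∂_x²)⁻¹f = w. -/
theorem integral_re_invSqrtOp_sq {f w : ℝ → ℝ} (hf : MemLp (fun x => (f x : ℂ)) 2 volume)
    (hw : MemLp (fun x => (w x : ℂ)) 2 volume)
    (h : (memLp_inv_symbol_four.toLp _ • 𝓕 (toL2 f) : L2) = 𝓕 (toL2 w)) :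
    Integrable (fun x => (invSqrtOp (toL2 f) x).re ^ 2) ∧
      ∫ x, (invSqrtOp (toL2 f) x).re ^ 2 = ∫ x, f x * w x := by
  set g := invSqrtOp (toL2 f) with hg
  have hstar : star g = g := star_multiplier_eq (hasTemperateGrowth_symbol_four_rpow _)
    memLp_symbol_four_rpow (fun ξ => by simp [symbol]) (star_toL2 hf)
  have hre : ∀ᵐ x, (g x).re ^ 2 = ‖g x‖ ^ 2 := by
    filter_upwards [Lp.coeFn_star g] with x hx
    rw [hstar, Pi.star_apply] at hx
    have : (g x).im = 0 := Complex.conj_eq_iff_im.mp hx.symm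
    rw [Complex.sq_norm, Complex.normSq_apply, this]
    ring
  have hint : Integrable (fun x => ‖g x‖ ^ 2) := (Lp.memLp g).integrable_norm_pow (by norm_num)
  refine ⟨hint.congr (hre.mono fun x hx => hx.symm), ?_⟩
  rw [integral_congr_ae hre]
  have h1 : ((‖g‖ ^ 2 : ℝ) : ℂ) = ((∫ x, f x * w x : ℝ) : ℂ) := by
    rw [norm_invSqrtOp_sq, h, Lp.inner_fourier_eq, inner_toL2 hf hw]
  rw [← Complex.ofReal_injective h1]
  have h2 := inner_self_eq_norm_sq_to_K (𝕜 := ℂ) g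
  rw [L2.inner_def] at h2
  apply Complex.ofReal_injective
  push_cast
  refine Eq.trans ?_ h2
  rw [← integral_complex_ofReal]
  refine integral_congr_ae (ae_of_all _ fun x => ?_)
  simp only [inner_self_eq_norm_sq_to_K]
  simp

/-- The symbol splits as 1 - 3/(4 + (2πξ)²), so this operator needs no inverse beyond w. -/
theorem momentumOp_toL2 {f w : ℝ → ℝ} (hf : MemLp (fun x => (f x : ℂ)) 2 volume)
    (hw : MemLp (fun x => (w x : ℂ)) 2 volume)
    (h : (memLp_inv_symbol_four.toLp _ • 𝓕 (toL2 f) : L2) = 𝓕 (toL2 w)) :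
    ∀ᵐ x, (momentumOp (toL2 f) x).re = f x - 3 * w x := by
  have h1 : (memLp_symbol_one_div_four.toLp _ • 𝓕 (toL2 f) : L2) =
      𝓕 (toL2 f - (3 : ℂ) • toL2 w) := by
    rw [sub_eq_add_neg, FourierTransform.fourier_add, ← neg_smul, FourierTransform.fourier_smul,
      ← h]
    refine Lp.ext ?_
    filter_upwards [Lp.coeFn_lpSMul (r := 2) (memLp_symbol_one_div_four.toLp _) (𝓕 (toL2 f)),
      Lp.coeFn_lpSMul (r := 2) (memLp_inv_symbol_four.toLp _) (𝓕 (toL2 f)),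
      memLp_symbol_one_div_four.coeFn_toLp, memLp_inv_symbol_four.coeFn_toLp,
      Lp.coeFn_add (𝓕 (toL2 f)) (-(3 : ℂ) • (memLp_inv_symbol_four.toLp _ • 𝓕 (toL2 f) : L2)),
      Lp.coeFn_smul (-(3 : ℂ)) (memLp_inv_symbol_four.toLp _ • 𝓕 (toL2 f) : L2)]
      with ξ e1 e2 e3 e4 e5 e6
    rw [e1, e5, Pi.add_apply, e6, Pi.smul_apply, e2, Pi.smul_apply', Pi.smul_apply', e3, e4]
    have h5 : symbol 1 ξ / symbol 4 ξ = 1 - 3 * symbol 4 ξ ^ (-1 : ℝ) := by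
      have := (symbol_four_pos ξ).ne'
      rw [rpow_neg_one]
      field_simp
      unfold symbol; ring
    rw [h5]
    simp only [smul_eq_mul]
    push_cast
    ring
  have h2 : momentumOp (toL2 f) = toL2 f - (3 : ℂ) • toL2 w := by
    rw [momentumOp, multiplier, h1, FourierTransform.fourierInv_fourier_eq]
  rw [h2]
  filter_upwards [Lp.coeFn_sub (toL2 f) ((3 : ℂ) • toL2 w), Lp.coeFn_smul (3 : ℂ) (toL2 w),
    coeFn_toL2 hf, coeFn_toL2 hw] with x e1 e2 e3 e4
  rw [e1, Pi.sub_apply, e2, Pi.smul_apply, e3, e4]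
  simp

/-! ### Derivatives along sequences at infinity, and a uniqueness lemma -/

/-- Only the profile is assumed to decay, not its derivatives. The mean value theorem on [x, x + 1]
gives points going to infinity where the derivative tends to 0, which is enough to evaluate a
constant of integration. -/
theorem exists_tendsto_deriv_comp_zero {f f' : ℝ → ℝ} (hf : ∀ x, HasDerivAt f (f' x) x)
    (h0 : Tendsto f atTop (𝓝 0)) :
    ∃ η : ℝ → ℝ, (∀ x, x < η x) ∧ Tendsto (fun x => f' (η x)) atTop (𝓝 0) := by
  have h : ∀ x : ℝ, ∃ y, x < y ∧ f' y = f (x + 1) - f x := fun x => by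
    obtain ⟨y, hy, hy'⟩ := exists_hasDerivAt_eq_slope f f' (lt_add_one x)
      (fun z _ => (hf z).continuousAt.continuousWithinAt) (fun z _ => hf z)
    exact ⟨y, hy.1, by rw [hy']; simp⟩
  choose η h1 h2 using h
  refine ⟨η, h1, ?_⟩
  simp_rw [h2]
  simpa using (h0.comp (tendsto_atTop_add_const_right _ 1 tendsto_id)).sub h0

theorem exists_tendsto_deriv_deriv_comp_zero {f f' f'' : ℝ → ℝ}
    (hf : ∀ x, HasDerivAt f (f' x) x) (hf' : ∀ x, HasDerivAt f' (f'' x) x)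
    (h0 : Tendsto f atTop (𝓝 0)) :
    ∃ η : ℝ → ℝ, (∀ x, x < η x) ∧ Tendsto (fun x => f'' (η x)) atTop (𝓝 0) := by
  -- The first-order statement for the unit difference of f makes f'(x + 1) - f'(x) small along η; a
  -- second mean value step turns this into a value of f''.
  obtain ⟨η, h1, h2⟩ := exists_tendsto_deriv_comp_zero (f := fun x => f (x + 1) - f x)
    (f' := fun x => f' (x + 1) - f' x)
    (fun x => ((hf (x + 1)).comp_add_const x 1).sub (hf x))
    (by simpa using (h0.comp (tendsto_atTop_add_const_right _ 1 tendsto_id)).sub h0)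
  have h : ∀ x : ℝ, ∃ y, x < y ∧ f'' y = f' (x + 1) - f' x := fun x => by
    obtain ⟨y, hy, hy'⟩ := exists_hasDerivAt_eq_slope f' f'' (lt_add_one x)
      (fun z _ => (hf' z).continuousAt.continuousWithinAt) (fun z _ => hf' z)
    exact ⟨y, hy.1, by rw [hy']; simp⟩
  choose ζ h3 h4 using h
  exact ⟨fun x => ζ (η x), fun x => (h1 x).trans (h3 _), by simpa only [h4] using h2⟩

/-- With k bounded by M on [a, b], |f'| ≤ √M |f|, and Grönwall applies. Squaring avoids choosing a
sign of f'. -/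
theorem eq_zero_of_sq_deriv_eq_of_le {f f' k : ℝ → ℝ} (hf : ∀ x, HasDerivAt f (f' x) x)
    (hk : Continuous k) (h : ∀ x, f' x ^ 2 = f x ^ 2 * k x) {a b : ℝ} (ha : f a = 0)
    (hab : a ≤ b) : f b = 0 := by
  obtain ⟨M, hM⟩ := isCompact_Icc.exists_bound_of_continuousOn (s := Icc a b) hk.continuousOn
  refine eq_zero_of_abs_deriv_le_mul_abs_self_of_eq_zero_right (K := √M)
    (fun x _ => (hf x).continuousAt.continuousWithinAt)
    (fun x _ => (hf x).hasDerivWithinAt) ha (fun x hx => ?_) b ⟨hab, le_rfl⟩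
  have h1 := hM x ⟨hx.1, hx.2.le⟩
  rw [Real.norm_eq_abs] at h1
  have h2 : 0 ≤ M := (abs_nonneg _).trans h1
  rw [Real.norm_eq_abs, Real.norm_eq_abs, ← abs_of_nonneg (sqrt_nonneg M), ← abs_mul]
  refine sq_le_sq.mp ?_
  rw [h, mul_pow, sq_sqrt h2, mul_comm]
  exact mul_le_mul_of_nonneg_right ((le_abs_self _).trans h1) (sq_nonneg _)

/-- A solution of `f'² = f² k` that vanishes at a point vanishes identically. -/
theorem eq_zero_of_sq_deriv_eq {f f' k : ℝ → ℝ} (hf : ∀ x, HasDerivAt f (f' x) x)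
    (hk : Continuous k) (h : ∀ x, f' x ^ 2 = f x ^ 2 * k x) {a : ℝ} (ha : f a = 0) (b : ℝ) :
    f b = 0 := by
  rcases le_total a b with hab | hab
  · exact eq_zero_of_sq_deriv_eq_of_le hf hk h ha hab
  · have := eq_zero_of_sq_deriv_eq_of_le (f := fun x => f (-x)) (f' := fun x => -f' (-x))
      (k := fun x => k (-x)) (a := -a) (b := -b)
      (fun x => ((hf (-x)).scomp x (hasDerivAt_neg x)).congr_deriv (by simp)) (by fun_prop)
      (fun x => by rw [neg_sq, h]) (by simpa using ha) (by linarith)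
    simpa using this

/-! ### Integrating the profile equation -/

variable {κ c : ℝ} {φ : ℝ → ℝ}

theorem IsSmoothSolitaryWave.hasDerivAt (h : IsSmoothSolitaryWave κ c φ) (x : ℝ) :
    HasDerivAt φ (deriv φ x) x :=
  (h.smooth.differentiable (by simp) x).hasDerivAt

theorem IsSmoothSolitaryWave.hasDerivAt_iteratedDeriv (h : IsSmoothSolitaryWave κ c φ) (n : ℕ)
    (x : ℝ) : HasDerivAt (iteratedDeriv n φ) (iteratedDeriv (n + 1) φ x) x := by
  rw [iteratedDeriv_succ]
  exact (h.smooth.differentiable_iteratedDeriv n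
    (WithTop.coe_lt_coe.mpr (ENat.natCast_lt_top n)) x).hasDerivAt

theorem IsSmoothSolitaryWave.hasDerivAt_deriv (h : IsSmoothSolitaryWave κ c φ) (x : ℝ) :
    HasDerivAt (deriv φ) (iteratedDeriv 2 φ x) x := by
  simpa only [iteratedDeriv_one] using h.hasDerivAt_iteratedDeriv 1 x

theorem IsSmoothSolitaryWave.travelling_eq (h : IsSmoothSolitaryWave κ c φ) (ξ : ℝ) :
    (φ ξ - c) * (deriv φ ξ - iteratedDeriv 3 φ ξ)
      + 3 * (φ ξ - iteratedDeriv 2 φ ξ + 2 * κ / 3) * deriv φ ξ = 0 := by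
  -- The equation is available only for t > 0; at t = 1 the point ξ + c has phase ξ.
  have hs := h.solves 1 one_pos (ξ + c)
  have hm : ∀ t x, momentumDensity (fun t x => φ (x - c * t)) t x =
      φ (x - c * t) - iteratedDeriv 2 φ (x - c * t) := fun t x => by
    unfold momentumDensity
    rw [iteratedDeriv_comp_sub_const]
  have hd := h.hasDerivAt
  have hd2 := h.hasDerivAt_iteratedDeriv 2
  have hM : ∀ x, HasDerivAt (fun x => φ x - iteratedDeriv 2 φ x)
      (deriv φ x - iteratedDeriv 3 φ x) x := fun x => (hd x).sub (hd2 x)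
  have e1 : deriv (fun s => momentumDensity (fun t x => φ (x - c * t)) s (ξ + c)) 1 =
      -c * (deriv φ ξ - iteratedDeriv 3 φ ξ) := by
    simp_rw [hm]
    have h1 : HasDerivAt (fun s : ℝ => ξ + c - c * s) (-c) 1 := by
      simpa using ((hasDerivAt_id (1 : ℝ)).const_mul c).const_sub (ξ + c)
    have h2 := hM (ξ + c - c * 1)
    have h3 := HasDerivAt.comp (1 : ℝ) h2 h1
    rw [show ξ + c - c * 1 = ξ by ring] at h3
    refine h3.deriv.trans ?_
    ring
  have e2 : deriv (momentumDensity (fun t x => φ (x - c * t)) 1) (ξ + c) =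
      deriv φ ξ - iteratedDeriv 3 φ ξ := by
    have h1 : momentumDensity (fun t x => φ (x - c * t)) 1 =
        fun x => (fun x => φ x - iteratedDeriv 2 φ x) (x - c * 1) := funext (hm 1)
    rw [h1, deriv_comp_sub_const (f := fun x => φ x - iteratedDeriv 2 φ x),
      show ξ + c - c * 1 = ξ by ring]
    exact (hM ξ).deriv
  have e3 : deriv (fun x => φ (x - c * 1)) (ξ + c) = deriv φ ξ := by
    rw [deriv_comp_sub_const, show ξ + c - c * 1 = ξ by ring]
  rw [e1, e2, hm] at hs
  simp only [e3] at hs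
  rw [show ξ + c - c * 1 = ξ by ring] at hs
  linear_combination hs

/-- The second order ordinary differential equation for the profile of a solitary wave. -/
theorem IsSmoothSolitaryWave.second_order (h : IsSmoothSolitaryWave κ c φ) (x : ℝ) :
    (c - φ x) ^ 3 * (φ x - iteratedDeriv 2 φ x + 2 * κ / 3) = 2 * κ / 3 * c ^ 3 := by
  have hd := h.hasDerivAt
  have hd1 := h.hasDerivAt_deriv
  have hd2 := h.hasDerivAt_iteratedDeriv 2
  have hK : ∀ y, HasDerivAt (fun x => (c - φ x) ^ 3 * (φ x - iteratedDeriv 2 φ x + 2 * κ / 3))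
      0 y := fun y => by
    have := (((hd y).const_sub c).pow 3).mul (((hd y).sub (hd2 y)).add_const (2 * κ / 3))
    refine this.congr_deriv ?_
    simp only [Pi.sub_apply, Pi.pow_apply]
    linear_combination -(c - φ y) ^ 2 * h.travelling_eq y
  have hconst : ∀ y, (c - φ y) ^ 3 * (φ y - iteratedDeriv 2 φ y + 2 * κ / 3) =
      (c - φ x) ^ 3 * (φ x - iteratedDeriv 2 φ x + 2 * κ / 3) := fun y =>
    is_const_of_deriv_eq_zero (fun y => (hK y).differentiableAt) (fun y => (hK y).deriv) y x
  have h0 : Tendsto φ atTop (𝓝 0) := h.decay.mono_left atTop_le_cocompact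
  obtain ⟨η, h1, h2⟩ := exists_tendsto_deriv_deriv_comp_zero hd hd1 h0
  have hη : Tendsto η atTop atTop := tendsto_atTop_mono (fun x => (h1 x).le) tendsto_id
  have h3 := h0.comp hη
  have h4 := ((tendsto_const_nhds (x := c)).sub h3).pow 3 |>.mul
    ((h3.sub h2).add (tendsto_const_nhds (x := 2 * κ / 3)))
  simp only [Function.comp_apply, hconst] at h4
  rw [tendsto_nhds_unique tendsto_const_nhds h4]
  ring

theorem IsSmoothSolitaryWave.lt_speed (hκ : 0 < κ) (hc : 0 < c)
    (h : IsSmoothSolitaryWave κ c φ) (x : ℝ) : φ x < c := by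
  -- At φ = c the left side of the second-order equation vanishes, but its right side is positive.
  -- Continuity and decay then keep φ below c.
  have hne : ∀ y, φ y ≠ c := fun y hy => by
    have := h.second_order y
    rw [hy, sub_self, zero_pow three_ne_zero, zero_mul] at this
    exact (by positivity : 2 * κ / 3 * c ^ 3 ≠ 0) this.symm
  by_contra! hx
  have h0 : Tendsto φ atTop (𝓝 0) := h.decay.mono_left atTop_le_cocompact
  obtain ⟨y, hy⟩ := (h0.eventually_lt_const hc).exists
  obtain ⟨z, hz⟩ := mem_range_of_exists_le_of_exists_ge h.smooth.continuous ⟨y, hy.le⟩ ⟨x, hx⟩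
  exact hne z hz

theorem IsSmoothSolitaryWave.iteratedDeriv_two (hκ : 0 < κ) (hc : 0 < c)
    (h : IsSmoothSolitaryWave κ c φ) (x : ℝ) :
    iteratedDeriv 2 φ x = φ x + 2 * κ / 3 - 2 * κ / 3 * c ^ 3 / (c - φ x) ^ 3 := by
  have := (sub_pos.mpr (h.lt_speed hκ hc x)).ne'
  field_simp
  linear_combination -3 * h.second_order x

/-- The first integral of the profile equation. -/
theorem IsSmoothSolitaryWave.first_order (hκ : 0 < κ) (hc : 0 < c)
    (h : IsSmoothSolitaryWave κ c φ) (x : ℝ) :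
    deriv φ x ^ 2 = φ x ^ 2 * (((φ x - (c - 2 * κ / 3)) ^ 2 - 2 * κ / 9 * (3 * c + 2 * κ)) /
      (c - φ x) ^ 2) := by
  have hlt : ∀ x, c - φ x ≠ 0 := fun x => (sub_pos.mpr (h.lt_speed hκ hc x)).ne'
  have hd := h.hasDerivAt
  have hd1 := h.hasDerivAt_deriv
  -- Energy obtained by multiplying the second-order equation by 2φ' and integrating; its value at
  -- infinity is 2κc/3.
  set E : ℝ → ℝ := fun x => deriv φ x ^ 2 - φ x ^ 2 - 4 * κ / 3 * φ x +
    2 * κ / 3 * c ^ 3 / (c - φ x) ^ 2 with hE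
  have hE0 : ∀ y, HasDerivAt E 0 y := fun y => by
    have := ((((hd1 y).pow 2).sub ((hd y).pow 2)).sub ((hd y).const_mul (4 * κ / 3))).add
      ((((hd y).const_sub c).pow 2).fun_inv (pow_ne_zero 2 (hlt y)) |>.const_mul
        (2 * κ / 3 * c ^ 3))
    refine (this.congr_of_eventuallyEq (Eventually.of_forall fun z => ?_)).congr_deriv ?_
    · simp [hE, div_eq_mul_inv]
    · have := hlt y
      simp only [Pi.pow_apply]
      rw [h.iteratedDeriv_two hκ hc]
      field_simp
      ring
  have hconst : ∀ y, E y = E x := fun y =>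
    is_const_of_deriv_eq_zero (fun y => (hE0 y).differentiableAt) (fun y => (hE0 y).deriv) y x
  have h0 : Tendsto φ atTop (𝓝 0) := h.decay.mono_left atTop_le_cocompact
  obtain ⟨η, h1, h2⟩ := exists_tendsto_deriv_comp_zero hd h0
  have hη : Tendsto η atTop atTop := tendsto_atTop_mono (fun x => (h1 x).le) tendsto_id
  have h3 := h0.comp hη
  have h4 : Tendsto (fun y => E (η y)) atTop
      (𝓝 (0 ^ 2 - 0 ^ 2 - 4 * κ / 3 * 0 + 2 * κ / 3 * c ^ 3 / (c - 0) ^ 2)) :=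
    (((h2.pow 2).sub (h3.pow 2)).sub (h3.const_mul _)).add
      (tendsto_const_nhds.div ((tendsto_const_nhds.sub h3).pow 2) (by simpa using hc.ne'))
  simp only [hconst] at h4
  have h5 := tendsto_nhds_unique tendsto_const_nhds h4
  simp only [hE] at h5
  have h6 := hlt x
  rw [show deriv φ x ^ 2 = φ x ^ 2 + 4 * κ / 3 * φ x - 2 * κ / 3 * c ^ 3 / (c - φ x) ^ 2 +
    2 * κ / 3 * c by
      rw [sub_zero c] at h5
      field_simp at h5 ⊢
      linear_combination h5]
  field_simp
  ring

theorem IsSmoothSolitaryWave.pos (hκ : 0 < κ) (hc : 2 * κ < c)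
    (h : IsSmoothSolitaryWave κ c φ) (x : ℝ) : 0 < φ x := by
  have hc0 : 0 < c := by linarith
  have hlt : ∀ x, c - φ x ≠ 0 := fun x => (sub_pos.mpr (h.lt_speed hκ hc0 x)).ne'
  have hcont := h.smooth.continuous
  have hd := h.hasDerivAt
  have hne : ∀ y, φ y ≠ 0 := fun y hy => by
    obtain ⟨z, hz⟩ := h.nontrivial
    refine hz (eq_zero_of_sq_deriv_eq hd ?_ (h.first_order hκ hc0) hy z)
    exact Continuous.div (by fun_prop) (by fun_prop) (fun x => pow_ne_zero 2 (hlt x))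
  by_contra! hx
  have hneg : φ x < 0 := lt_of_le_of_ne hx (hne x)
  -- A negative value would produce a negative minimum, where φ' = 0. But (φ - p)² - d equals c² -
  -- 2cκ > 0 at φ = 0 and is larger for φ < 0, contradicting the first integral.
  obtain ⟨y, hy⟩ := hcont.exists_forall_le' x ((h.decay.eventually_const_lt hneg).mono
    fun z hz => hz.le)
  have hy0 : φ y < 0 := (hy x).trans_lt hneg
  have hdy : deriv φ y = 0 := (IsLocalMin.hasDerivAt_eq_zero
    (Eventually.of_forall hy : IsLocalMin φ y) (hd y))
  have h1 := h.first_order hκ hc0 y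
  rw [hdy] at h1
  have h2 : 0 < (φ y - (c - 2 * κ / 3)) ^ 2 - 2 * κ / 9 * (3 * c + 2 * κ) := by
    nlinarith [mul_pos (neg_pos.mpr hy0) hκ, mul_pos (neg_pos.mpr hy0) (sub_pos.mpr hc),
      sq_nonneg (φ y), mul_pos hc0 (sub_pos.mpr hc)]
  have h3 : 0 < (c - φ y) ^ 2 := by have := hlt y; positivity
  have h4 : 0 < φ y ^ 2 := by have := hne y; positivity
  have := mul_pos h4 (div_pos h2 h3)
  linarith

/-- The profile is governed by a first order system with a quadratic first integral. -/
theorem IsSmoothSolitaryWave.exists_reduction (hκ : 0 < κ) (hc : 2 * κ < c)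
    (h : IsSmoothSolitaryWave κ c φ) :
    ∃ r : ℝ → ℝ, (∀ x, φ x < c - 2 * κ / 3) ∧
      (∀ x, HasDerivAt φ (r x * φ x / (c - φ x)) x) ∧
      (∀ x, HasDerivAt r ((φ x - (c - 2 * κ / 3)) * φ x / (c - φ x)) x) ∧
      ∀ x, r x ^ 2 = (φ x - (c - 2 * κ / 3)) ^ 2 - 2 * κ / 9 * (3 * c + 2 * κ) := by
  have hc0 : 0 < c := by linarith
  have hlt : ∀ x, c - φ x ≠ 0 := fun x => (sub_pos.mpr (h.lt_speed hκ hc0 x)).ne'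
  have hpos := h.pos hκ hc
  have hd := h.hasDerivAt
  have hd1 := h.hasDerivAt_deriv
  have hsq : ∀ x, ((c - φ x) * deriv φ x / φ x) ^ 2 =
      (φ x - (c - 2 * κ / 3)) ^ 2 - 2 * κ / 9 * (3 * c + 2 * κ) := fun x => by
    have h1 := (hpos x).ne'
    have h2 := hlt x
    rw [div_pow, mul_pow, h.first_order hκ hc0]
    field_simp
  refine ⟨fun x => (c - φ x) * deriv φ x / φ x, fun x => ?_, fun x => ?_, fun x => ?_, hsq⟩
  -- If p ≤ φ < c then (φ - p)² < 4κ²/9 < d, contradicting r² ≥ 0.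
  · by_contra! hx
    have h1 := sq_nonneg ((c - φ x) * deriv φ x / φ x)
    rw [hsq] at h1
    have h2 := h.lt_speed hκ hc0 x
    nlinarith [mul_pos hκ hc0]
  · have h1 := (hpos x).ne'
    have h2 := hlt x
    refine (hd x).congr_deriv ?_
    field_simp
  · have h1 := (hpos x).ne'
    have h2 := hlt x
    refine ((((hd x).const_sub c).mul (hd1 x)).div (hd x) h1).congr_deriv ?_
    have h3 := h.first_order hκ hc0 x
    simp only [Pi.mul_apply]
    rw [div_eq_iff (pow_ne_zero 2 h1)]
    trans ((c - φ x) * φ x * iteratedDeriv 2 φ x - c * deriv φ x ^ 2)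
    · ring
    · rw [h3, h.iteratedDeriv_two hκ hc0]
      field_simp
      ring

/-! ### The integrals of φ² and φ³ -/

/-- If a function has limits at `± ∞` and a nonnegative derivative, then the derivative is
integrable, and its integral is the difference of the limits. -/
theorem integral_of_hasDerivAt_of_nonneg {f f' : ℝ → ℝ} {a b : ℝ}
    (hf : ∀ x, HasDerivAt f (f' x) x) (hpos : ∀ x, 0 ≤ f' x) (hbot : Tendsto f atBot (𝓝 a))
    (htop : Tendsto f atTop (𝓝 b)) : Integrable f' ∧ ∫ x, f' x = b - a := by
  have h1 : IntegrableOn f' (Ioi 0) :=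
    integrableOn_Ioi_deriv_of_nonneg' (fun x _ => hf x) (fun x _ => hpos x) htop
  have h2 : IntegrableOn (fun x => f' (-x)) (Ioi 0) :=
    integrableOn_Ioi_deriv_of_nonneg' (g := fun x => -f (-x)) (l := -a)
      (fun x _ => ((hf (-x)).scomp x (hasDerivAt_neg x)).neg.congr_deriv (by simp))
      (fun x _ => hpos (-x)) (hbot.comp tendsto_neg_atTop_atBot).neg
  have h3 : IntegrableOn f' (Iic 0) := by
    rw [integrableOn_Iic_iff_integrableOn_Iio]
    have := IntegrableOn.comp_neg_Iio (c := (0 : ℝ)) (f := fun x => f' (-x)) (by rwa [neg_zero])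
    simpa only [neg_neg] using this
  have h4 : Integrable f' := by
    rw [← integrableOn_univ, ← Iic_union_Ioi (a := (0 : ℝ))]
    exact h3.union h1
  exact ⟨h4, integral_of_hasDerivAt_of_tendsto hf h4 hbot htop⟩

/-- The squared amplitude of `r` in the parametrization of a solitary wave by hyperbolic
functions. -/
def dsq (κ c : ℝ) : ℝ := 2 * κ / 9 * (3 * c + 2 * κ)

/-- The limit of the hyperbolic angle at `+ ∞` along a solitary wave of speed `c`. -/
def limitAngle (κ c : ℝ) : ℝ := arsinh (√(c ^ 2 - 2 * c * κ) / √(dsq κ c))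

/-- The value of `∫ φ²` for a solitary wave of speed `c`. -/
def integralSq (κ c : ℝ) : ℝ :=
  2 * (((c - 2 * κ / 3) * (2 * κ / 3) - dsq κ c / 2) * limitAngle κ c
    + (c - 2 * κ / 3 - 2 * κ / 3) * √(c ^ 2 - 2 * c * κ)
    - √(c ^ 2 - 2 * c * κ) * (c - 2 * κ / 3) / 2)

/-- The value of `∫ φ³` for a solitary wave of speed `c`. -/
def integralCube (κ c : ℝ) : ℝ :=
  2 * (((c - 2 * κ / 3) ^ 2 * (2 * κ / 3) +
      (2 * κ / 3 - 2 * (c - 2 * κ / 3)) * dsq κ c / 2) * limitAngle κ c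
    + ((c - 2 * κ / 3) ^ 2 - 2 * (c - 2 * κ / 3) * (2 * κ / 3)) * √(c ^ 2 - 2 * c * κ)
    + (2 * κ / 3 - 2 * (c - 2 * κ / 3)) * √(c ^ 2 - 2 * c * κ) * (c - 2 * κ / 3) / 2
    + dsq κ c * √(c ^ 2 - 2 * c * κ) + √(c ^ 2 - 2 * c * κ) ^ 3 / 3)


theorem dsq_pos (hκ : 0 < κ) (hc : 2 * κ < c) : 0 < dsq κ c := by
  have : 0 < c := by linarith
  unfold dsq; positivity

theorem radicand_pos (hκ : 0 < κ) (hc : 2 * κ < c) : 0 < c ^ 2 - 2 * c * κ := by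
  nlinarith

/-- r is strictly decreasing with |r| < s, and r² → p² - d = s² at both ends. Monotone limits exist,
and strict bounds at 0 decide their signs. -/
theorem tendsto_reduction {r : ℝ → ℝ} (hκ : 0 < κ) (hc : 2 * κ < c)
    (hpos : ∀ x, 0 < φ x) (hdecay : Tendsto φ (cocompact ℝ) (𝓝 0))
    (hlt : ∀ x, φ x < c - 2 * κ / 3)
    (hr : ∀ x, HasDerivAt r ((φ x - (c - 2 * κ / 3)) * φ x / (c - φ x)) x)
    (hsq : ∀ x, r x ^ 2 = (φ x - (c - 2 * κ / 3)) ^ 2 - dsq κ c) :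
    Tendsto r atTop (𝓝 (-√(c ^ 2 - 2 * c * κ))) ∧ Tendsto r atBot (𝓝 √(c ^ 2 - 2 * c * κ)) := by
  have hs := radicand_pos hκ hc
  set s := √(c ^ 2 - 2 * c * κ)
  have hs2 : s ^ 2 = c ^ 2 - 2 * c * κ := sq_sqrt hs.le
  have hs0 : 0 ≤ s := sqrt_nonneg _
  have hanti : StrictAnti r := strictAnti_of_hasDerivAt_neg hr fun x => by
    have := hlt x
    exact div_neg_of_neg_of_pos (mul_neg_of_neg_of_pos (by linarith) (hpos x)) (by linarith)
  have hbd : ∀ x, |r x| < s := fun x => by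
    refine abs_lt_of_sq_lt_sq ?_ hs0
    rw [hsq, hs2]
    unfold dsq
    nlinarith [hlt x, hpos x, mul_pos (hpos x) (sub_pos.mpr (hlt x))]
  have hlim : ∀ l : Filter ℝ, l ≤ cocompact ℝ → Tendsto (fun x => r x ^ 2) l (𝓝 (s ^ 2)) :=
    fun l hl => by
      simp_rw [hsq]
      have := (((hdecay.mono_left hl).sub_const (c - 2 * κ / 3)).pow 2).sub_const (dsq κ c)
      convert this using 2
      rw [hs2]; unfold dsq; ring
  constructor
  · have h1 := tendsto_atTop_ciInf hanti.antitone
      ⟨-s, by rintro _ ⟨x, rfl⟩; exact (abs_lt.mp (hbd x)).1.le⟩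
    set l := ⨅ x, r x
    have h2 := tendsto_nhds_unique (h1.pow 2) (hlim _ atTop_le_cocompact)
    have h3 : l < s := (hanti.antitone.le_of_tendsto h1 0).trans_lt (abs_lt.mp (hbd 0)).2
    rcases sq_eq_sq_iff_eq_or_eq_neg.mp h2 with h | h
    · exact absurd h h3.ne
    · rwa [h] at h1
  · have h1 := tendsto_atBot_ciSup hanti.antitone
      ⟨s, by rintro _ ⟨x, rfl⟩; exact (abs_lt.mp (hbd x)).2.le⟩
    set l := ⨆ x, r x
    have h2 := tendsto_nhds_unique (h1.pow 2) (hlim _ atBot_le_cocompact)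
    have h3 : -s < l := (abs_lt.mp (hbd 0)).1.trans_le (hanti.antitone.ge_of_tendsto h1 0)
    rcases sq_eq_sq_iff_eq_or_eq_neg.mp h2 with h | h
    · rwa [h] at h1
    · exact absurd h h3.ne'

/-- On the branch φ < p one has p - φ = √d cosh θ and r = -√d sinh θ, so θ' = -r'/(p - φ). -/
theorem hasDerivAt_angle {r : ℝ → ℝ} (hκ : 0 < κ) (hc : 2 * κ < c)
    (hlt : ∀ x, φ x < c - 2 * κ / 3)
    (hr : ∀ x, HasDerivAt r ((φ x - (c - 2 * κ / 3)) * φ x / (c - φ x)) x)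
    (hsq : ∀ x, r x ^ 2 = (φ x - (c - 2 * κ / 3)) ^ 2 - dsq κ c) (x : ℝ) :
    HasDerivAt (fun x => arsinh (-r x / √(dsq κ c))) (φ x / (c - φ x)) x := by
  have hd := dsq_pos hκ hc
  have hd' := sqrt_pos.mpr hd
  have h1 : √(1 + (-r x / √(dsq κ c)) ^ 2) = (c - 2 * κ / 3 - φ x) / √(dsq κ c) := by
    rw [sqrt_eq_iff_eq_sq (by positivity) (div_nonneg (by linarith [hlt x]) hd'.le), div_pow,
      div_pow, neg_sq, hsq, sq_sqrt hd.le]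
    field_simp
    ring
  refine (((hr x).neg.div_const _).arsinh).congr_deriv ?_
  have h2 : c - 2 * κ / 3 - φ x ≠ 0 := (sub_pos.mpr (hlt x)).ne'
  have h3 : c - φ x ≠ 0 := by have := hlt x; intro; linarith
  simp only [Pi.neg_apply]
  rw [h1, smul_eq_mul]
  generalize c - 2 * κ / 3 = p at h2
  field_simp
  ring

theorem integral_eq_of_primitive {θ r φ f : ℝ → ℝ} {G : ℝ → ℝ → ℝ → ℝ} {L s : ℝ}
    (hG : Continuous fun z : ℝ × ℝ × ℝ => G z.1 z.2.1 z.2.2)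
    (hθtop : Tendsto θ atTop (𝓝 L)) (hθbot : Tendsto θ atBot (𝓝 (-L)))
    (hrtop : Tendsto r atTop (𝓝 (-s))) (hrbot : Tendsto r atBot (𝓝 s))
    (hφtop : Tendsto φ atTop (𝓝 0)) (hφbot : Tendsto φ atBot (𝓝 0))
    (hf : ∀ x, HasDerivAt (fun x => G (θ x) (r x) (φ x)) (f x) x) (hpos : ∀ x, 0 ≤ f x) :
    Integrable f ∧ ∫ x, f x = G L (-s) 0 - G (-L) s 0 :=
  integral_of_hasDerivAt_of_nonneg hf hpos
    ((hG.tendsto (-L, s, 0)).comp (hθbot.prodMk_nhds (hrbot.prodMk_nhds hφbot)))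
    ((hG.tendsto (L, -s, 0)).comp (hθtop.prodMk_nhds (hrtop.prodMk_nhds hφtop)))

/-- Here q = 2κ/3, so p + q = c. With y = p - φ, φ² = θ'(p - y)(q + y). The powers of y integrate by
yθ' = -r' and (ry)' = -(y² + r²)θ', where r² = y² - d. -/
theorem hasDerivAt_primitive_sq {θ r φ : ℝ → ℝ} {p q d x : ℝ} (h0 : p + q - φ x ≠ 0)
    (hθ : HasDerivAt θ (φ x / (p + q - φ x)) x)
    (hφ : HasDerivAt φ (r x * φ x / (p + q - φ x)) x)
    (hr : HasDerivAt r ((φ x - p) * φ x / (p + q - φ x)) x)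
    (hsq : r x ^ 2 = (φ x - p) ^ 2 - d) :
    HasDerivAt (fun x => (p * q - d / 2) * θ x - (p - q) * r x + r x * (p - φ x) / 2)
      (φ x ^ 2) x := by
  refine (((hθ.const_mul (p * q - d / 2)).sub (hr.const_mul (p - q))).add
    ((hr.mul (hφ.const_sub p)).div_const 2)).congr_deriv ?_
  trans φ x / (p + q - φ x) * (p * q - d / 2 - (p - q) * (φ x - p) - (φ x - p) ^ 2 / 2
    - r x ^ 2 / 2)
  · ring
  trans φ x / (p + q - φ x) * (φ x * (p + q - φ x))
  · congr 1
    linear_combination -hsq / 2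
  · field_simp

/-- The same expansion for θ'(p - y)²(q + y); the new term is y³θ' = -(d + r²)r', with primitive
-(dr + r³/3). -/
theorem hasDerivAt_primitive_cube {θ r φ : ℝ → ℝ} {p q d x : ℝ} (h0 : p + q - φ x ≠ 0)
    (hθ : HasDerivAt θ (φ x / (p + q - φ x)) x)
    (hφ : HasDerivAt φ (r x * φ x / (p + q - φ x)) x)
    (hr : HasDerivAt r ((φ x - p) * φ x / (p + q - φ x)) x)
    (hsq : r x ^ 2 = (φ x - p) ^ 2 - d) :
    HasDerivAt (fun x => (p ^ 2 * q + (q - 2 * p) * d / 2) * θ x - (p ^ 2 - 2 * p * q) * r x -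
        (q - 2 * p) * (r x * (p - φ x)) / 2 - (d * r x + r x ^ 3 / 3))
      (φ x ^ 3) x := by
  refine ((((hθ.const_mul (p ^ 2 * q + (q - 2 * p) * d / 2)).sub
    (hr.const_mul (p ^ 2 - 2 * p * q))).sub
    (((hr.mul (hφ.const_sub p)).const_mul (q - 2 * p)).div_const 2)).sub
    ((hr.const_mul d).add ((hr.pow 3).div_const 3))).congr_deriv ?_
  trans φ x / (p + q - φ x) * (p ^ 2 * q + (q - 2 * p) * d / 2 - (p ^ 2 - 2 * p * q) * (φ x - p)
    + (q - 2 * p) * ((φ x - p) ^ 2 + r x ^ 2) / 2 - d * (φ x - p) - r x ^ 2 * (φ x - p))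
  · simp only [Nat.cast_ofNat, Nat.add_one_sub_one]
    ring
  trans φ x / (p + q - φ x) * (φ x ^ 2 * (p + q - φ x))
  · congr 1
    linear_combination ((q - 2 * p) / 2 - (φ x - p)) * hsq
  · field_simp

theorem integral_sq_and_cube {r : ℝ → ℝ} (hκ : 0 < κ) (hc : 2 * κ < c)
    (hpos : ∀ x, 0 < φ x) (hdecay : Tendsto φ (cocompact ℝ) (𝓝 0))
    (hlt : ∀ x, φ x < c - 2 * κ / 3)
    (hφ : ∀ x, HasDerivAt φ (r x * φ x / (c - φ x)) x)
    (hr : ∀ x, HasDerivAt r ((φ x - (c - 2 * κ / 3)) * φ x / (c - φ x)) x)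
    (hsq : ∀ x, r x ^ 2 = (φ x - (c - 2 * κ / 3)) ^ 2 - dsq κ c) :
    (Integrable (fun x => φ x ^ 2) ∧ ∫ x, φ x ^ 2 = integralSq κ c) ∧
    (Integrable (fun x => φ x ^ 3) ∧ ∫ x, φ x ^ 3 = integralCube κ c) := by
  obtain ⟨htop, hbot⟩ := tendsto_reduction hκ hc hpos hdecay hlt hr hsq
  have hθ := hasDerivAt_angle hκ hc hlt hr hsq
  set s := √(c ^ 2 - 2 * c * κ) with hs
  have hne : ∀ x, c - φ x ≠ 0 := fun x hx => by have := hlt x; linarith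
  set θ : ℝ → ℝ := fun x => arsinh (-r x / √(dsq κ c))
  have hθtop : Tendsto θ atTop (𝓝 (limitAngle κ c)) := by
    have h1 : Continuous fun y : ℝ => arsinh (-y / √(dsq κ c)) :=
      continuous_arsinh.comp (continuous_neg.div_const _)
    have := (h1.tendsto (-s)).comp htop
    rwa [neg_neg] at this
  have hθbot : Tendsto θ atBot (𝓝 (-limitAngle κ c)) := by
    have h1 : Continuous fun y : ℝ => arsinh (-y / √(dsq κ c)) :=
      continuous_arsinh.comp (continuous_neg.div_const _)
    have := (h1.tendsto s).comp hbot
    rwa [neg_div, arsinh_neg] at this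
  have hφtop := hdecay.mono_left atTop_le_cocompact
  have hφbot := hdecay.mono_left atBot_le_cocompact
  have hpq : c = (c - 2 * κ / 3) + 2 * κ / 3 := by ring
  have hθ' : ∀ x, HasDerivAt θ (φ x / ((c - 2 * κ / 3) + 2 * κ / 3 - φ x)) x := fun x => by
    rw [← hpq]; exact hθ x
  have hφ' : ∀ x, HasDerivAt φ (r x * φ x / ((c - 2 * κ / 3) + 2 * κ / 3 - φ x)) x := fun x => by
    rw [← hpq]; exact hφ x
  have hr' : ∀ x, HasDerivAt r ((φ x - (c - 2 * κ / 3)) * φ x /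
      ((c - 2 * κ / 3) + 2 * κ / 3 - φ x)) x := fun x => by
    rw [← hpq]; exact hr x
  have hne' : ∀ x, (c - 2 * κ / 3) + 2 * κ / 3 - φ x ≠ 0 := fun x => by rw [← hpq]; exact hne x
  constructor
  · have := integral_eq_of_primitive (θ := θ) (r := r) (φ := φ) (f := fun x => φ x ^ 2)
      (G := fun θ r φ => ((c - 2 * κ / 3) * (2 * κ / 3) - dsq κ c / 2) * θ -
        (c - 2 * κ / 3 - 2 * κ / 3) * r + r * (c - 2 * κ / 3 - φ) / 2)
      (by fun_prop) hθtop hθbot htop hbot hφtop hφbot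
      (fun x => hasDerivAt_primitive_sq (hne' x) (hθ' x) (hφ' x) (hr' x) (hsq x))
      (fun x => sq_nonneg _)
    refine ⟨this.1, this.2.trans ?_⟩
    unfold integralSq
    ring
  · have := integral_eq_of_primitive (θ := θ) (r := r) (φ := φ) (f := fun x => φ x ^ 3)
      (G := fun θ r φ => ((c - 2 * κ / 3) ^ 2 * (2 * κ / 3) +
        (2 * κ / 3 - 2 * (c - 2 * κ / 3)) * dsq κ c / 2) * θ -
        ((c - 2 * κ / 3) ^ 2 - 2 * (c - 2 * κ / 3) * (2 * κ / 3)) * r -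
        (2 * κ / 3 - 2 * (c - 2 * κ / 3)) * (r * (c - 2 * κ / 3 - φ)) / 2 -
        (dsq κ c * r + r ^ 3 / 3))
      (by fun_prop) hθtop hθbot htop hbot hφtop hφbot
      (fun x => hasDerivAt_primitive_cube (hne' x) (hθ' x) (hφ' x) (hr' x) (hsq x))
      (fun x => pow_nonneg (hpos x).le 3)
    refine ⟨this.1, this.2.trans ?_⟩
    unfold integralCube
    ring

/-! ### `H` and `S` in terms of the two integrals -/

theorem memLp_ofReal_mul {f g : ℝ → ℝ} {C : ℝ} (hg : MemLp (fun x => (g x : ℂ)) 2 volume)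
    (hf : Continuous f) (h : ∀ x, |f x| ≤ C * |g x|) :
    MemLp (fun x => (f x : ℂ)) 2 volume :=
  hg.of_le_mul (c := C) (by fun_prop) (ae_of_all _ fun x => by simpa using h x)

theorem IsSmoothSolitaryWave.memLp_and_energies (hκ : 0 < κ) (hc : 2 * κ < c)
    (h : IsSmoothSolitaryWave κ c φ) :
    (MemLp φ 2 volume ∧ Integrable (fun x => φ x ^ 3) volume) ∧
    S φ = (2 * κ * integralSq κ c + 3 / 2 * integralCube κ c) / (2 * (3 * c + 2 * κ)) ∧
    H κ φ = -((3 * c - κ) * integralCube κ c + 6 * κ * c * integralSq κ c) /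
      (6 * (3 * c + 2 * κ)) := by
  have hc0 : 0 < c := by linarith
  have hD : 0 < 3 * c + 2 * κ := by linarith
  obtain ⟨r, hlt, hφ, hr, hsq⟩ := h.exists_reduction hκ hc
  have hpos := h.pos hκ hc
  obtain ⟨⟨i2, e2⟩, i3, e3⟩ := integral_sq_and_cube hκ hc hpos h.decay hlt hφ hr hsq
  have hcont := h.smooth.continuous
  have hrcont : Continuous r := continuous_iff_continuousAt.mpr fun x => (hr x).continuousAt
  have hmem : MemLp φ 2 volume :=
    (memLp_two_iff_integrable_sq hcont.aestronglyMeasurable).mpr i2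
  have hf : MemLp (fun x => (φ x : ℂ)) 2 volume := hmem.ofReal
  have hne : ∀ x, c - φ x ≠ 0 := fun x hx => by have := hlt x; linarith
  set D := 3 * c + 2 * κ
  -- This w is chosen because (cφ - φ²/2)' = (c - φ)φ' = rφ, and (rφ)' = 4(cφ - φ²/2) - Dφ by the
  -- quadratic relation for r. Hence 4w - w'' = φ.
  have hw : ∀ x, HasDerivAt (fun x => (c * φ x - φ x ^ 2 / 2) / D) (r x * φ x / D) x := fun x => by
    refine ((((hφ x).const_mul c).sub (((hφ x).pow 2).div_const 2)).div_const D).congr_deriv ?_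
    have := hne x
    simp only [Nat.cast_ofNat, Nat.add_one_sub_one, pow_one]
    field_simp
  have hw' : ∀ x, HasDerivAt (fun x => r x * φ x / D)
      (4 * ((c * φ x - φ x ^ 2 / 2) / D) - φ x) x := fun x => by
    refine (((hr x).mul (hφ x)).div_const D).congr_deriv ?_
    have h1 := hne x
    have h2 := hsq x
    rw [div_eq_iff hD.ne']
    trans φ x ^ 2 / (c - φ x) * (φ x - (c - 2 * κ / 3)) + r x ^ 2 * φ x / (c - φ x)
    · ring
    · rw [h2]
      field_simp
      ring
  have mw : MemLp (fun x => (((c * φ x - φ x ^ 2 / 2) / D : ℝ) : ℂ)) 2 volume := by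
    refine memLp_ofReal_mul (C := c / D) hf (by fun_prop) fun x => ?_
    have h1 := hpos x
    have h2 := hlt x
    rw [abs_of_pos h1, abs_of_nonneg (div_nonneg (by nlinarith) hD.le), div_mul_eq_mul_div]
    gcongr
    nlinarith
  have mw' : MemLp (fun x => ((r x * φ x / D : ℝ) : ℂ)) 2 volume := by
    refine memLp_ofReal_mul (C := c / D) hf (by fun_prop) fun x => ?_
    have h1 := hpos x
    have h2 := hlt x
    rw [abs_div, abs_mul, abs_of_pos hD, div_mul_eq_mul_div]
    gcongr
    refine abs_le_of_sq_le_sq ?_ hc0.le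
    rw [hsq]
    nlinarith [mul_pos hκ hc0, mul_pos h1 (sub_pos.mpr h2)]
  have mw'' : MemLp (fun x => ((4 * ((c * φ x - φ x ^ 2 / 2) / D) - φ x : ℝ) : ℂ)) 2 volume := by
    have := (mw.const_mul 4).sub hf
    refine this.congr_norm (by fun_prop) (ae_of_all _ fun x => ?_)
    simp
  have hmul := inv_symbol_smul_fourier_eq hw hw' (fun x => by ring) mw mw' mw'' hf
  obtain ⟨ig, eg⟩ := integral_re_invSqrtOp_sq hf mw hmul
  refine ⟨⟨hmem, i3⟩, ?_, ?_⟩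
  · have e1 : ∫ x, φ x * (momentumOp (toL2 φ) x).re =
        ∫ x, (2 * κ / D * φ x ^ 2 + 3 / 2 / D * φ x ^ 3) := by
      refine integral_congr_ae ?_
      filter_upwards [momentumOp_toL2 hf mw hmul] with x hx
      rw [hx]
      field_simp
      ring
    rw [S, e1, integral_add (i2.const_mul _) (i3.const_mul _), integral_const_mul,
      integral_const_mul, e2, e3]
    field_simp
  · have e1 : ∫ x, φ x * ((c * φ x - φ x ^ 2 / 2) / D) =
        ∫ x, (c / D * φ x ^ 2 - 1 / 2 / D * φ x ^ 3) := by
      refine integral_congr_ae (ae_of_all _ fun x => ?_)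
      field_simp
    rw [H, integral_add i3 (ig.const_mul _), integral_const_mul, eg, e1,
      integral_sub (i2.const_mul _) (i3.const_mul _), integral_const_mul,
      integral_const_mul, e2, e3]
    field_simp
    ring

/-! ### Differentiation in the speed -/

theorem hasDerivAt_sqrt_radicand (hκ : 0 < κ) (hc : 2 * κ < c) :
    HasDerivAt (fun b => √(b ^ 2 - 2 * b * κ)) ((c - κ) / √(c ^ 2 - 2 * c * κ)) c := by
  have h1 : HasDerivAt (fun b : ℝ => b ^ 2 - 2 * b * κ) (2 * c - 2 * κ) c := by
    refine (((hasDerivAt_id c).pow 2).sub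
      (((hasDerivAt_id c).const_mul 2).mul_const κ)).congr_deriv ?_
    simp
  refine (h1.sqrt (radicand_pos hκ hc).ne').congr_deriv ?_
  have := sqrt_pos.mpr (radicand_pos hκ hc)
  field_simp

theorem hasDerivAt_limitAngle (hκ : 0 < κ) (hc : 2 * κ < c) :
    HasDerivAt (limitAngle κ)
      (3 * (c + 2 * κ) / (2 * √(c ^ 2 - 2 * c * κ) * (3 * c + 2 * κ))) c := by
  have hd := dsq_pos hκ hc
  have hs := radicand_pos hκ hc
  have hd' := sqrt_pos.mpr hd
  have hs' := sqrt_pos.mpr hs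
  have hD : 0 < 3 * c + 2 * κ := by linarith
  have h1 : HasDerivAt (dsq κ) (2 * κ / 3) c := by
    refine ((((hasDerivAt_id c).const_mul 3).add_const (2 * κ)).const_mul
      (2 * κ / 9)).congr_deriv ?_
    ring
  -- The hyperbolic cosine of the limit angle, from s² + d = p².
  have h2 : √(1 + (√(c ^ 2 - 2 * c * κ) / √(dsq κ c)) ^ 2) = (c - 2 * κ / 3) / √(dsq κ c) := by
    rw [sqrt_eq_iff_eq_sq (by positivity) (div_nonneg (by linarith) hd'.le), div_pow,
      div_pow, sq_sqrt hd.le, sq_sqrt hs.le]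
    field_simp
    unfold dsq
    ring
  refine (((hasDerivAt_sqrt_radicand hκ hc).div (h1.sqrt hd.ne') hd'.ne').arsinh).congr_deriv ?_
  have h3 : c - 2 * κ / 3 ≠ 0 := by intro; linarith
  have h4 : √(dsq κ c) ^ 2 = dsq κ c := sq_sqrt hd.le
  have h5 : √(c ^ 2 - 2 * c * κ) ^ 2 = c ^ 2 - 2 * c * κ := sq_sqrt hs.le
  simp only [Pi.div_apply]
  rw [h2, smul_eq_mul]
  set s := √(c ^ 2 - 2 * c * κ)
  set t := √(dsq κ c)
  trans ((c - κ) * t ^ 2 - s ^ 2 * κ / 3) / ((c - 2 * κ / 3) * s * t ^ 2)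
  · field_simp
  · rw [h4, h5]
    unfold dsq
    rw [div_eq_div_iff (by positivity) (by positivity)]
    ring

/-- The value of `S` at a solitary wave of speed `c`. -/
theorem momentum_closed_form (hκ : 0 < κ) (hc : 2 * κ < c) :
    (2 * κ * integralSq κ c + 3 / 2 * integralCube κ c) / (2 * (3 * c + 2 * κ)) =
      -(κ ^ 2 / 9) * limitAngle κ c +
        √(c ^ 2 - 2 * c * κ) * (c ^ 2 / (2 * (3 * c + 2 * κ)) - κ / 6) := by
  have hD : 3 * c + 2 * κ ≠ 0 := by intro; linarith
  have h5 : √(c ^ 2 - 2 * c * κ) ^ 3 = (c ^ 2 - 2 * c * κ) * √(c ^ 2 - 2 * c * κ) := by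
    rw [pow_succ, sq_sqrt (radicand_pos hκ hc).le]
  unfold integralSq integralCube
  rw [h5]
  unfold dsq
  have hX : c ^ 2 / (2 * (3 * c + 2 * κ)) * (2 * (3 * c + 2 * κ)) = c ^ 2 :=
    div_mul_cancel₀ _ (mul_ne_zero two_ne_zero hD)
  rw [div_eq_iff (mul_ne_zero two_ne_zero hD)]
  linear_combination -√(c ^ 2 - 2 * c * κ) * hX

/-- The value of `H` at a solitary wave of speed `c`. -/
theorem hamiltonian_closed_form (hκ : 0 < κ) (hc : 2 * κ < c) :
    -((3 * c - κ) * integralCube κ c + 6 * κ * c * integralSq κ c) / (6 * (3 * c + 2 * κ)) =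
      10 * κ ^ 3 / 81 * limitAngle κ c - √(c ^ 2 - 2 * c * κ) *
        ((c ^ 3 - κ * c ^ 2 / 3) / (3 * (3 * c + 2 * κ)) - 5 * κ ^ 2 / 27) := by
  have hD : 3 * c + 2 * κ ≠ 0 := by intro; linarith
  have h5 : √(c ^ 2 - 2 * c * κ) ^ 3 = (c ^ 2 - 2 * c * κ) * √(c ^ 2 - 2 * c * κ) := by
    rw [pow_succ, sq_sqrt (radicand_pos hκ hc).le]
  unfold integralSq integralCube
  rw [h5]
  unfold dsq
  have hX : (c ^ 3 - κ * c ^ 2 / 3) / (3 * (3 * c + 2 * κ)) * (3 * (3 * c + 2 * κ)) =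
      c ^ 3 - κ * c ^ 2 / 3 := div_mul_cancel₀ _ (mul_ne_zero three_ne_zero hD)
  rw [div_eq_iff (mul_ne_zero (by norm_num) hD)]
  linear_combination 2 * √(c ^ 2 - 2 * c * κ) * hX

/-- The angle differentiates to a rational function of c divided by s, as does the root itself;
replacing s² by c² - 2cκ collects everything into a rational multiple of s. -/
theorem hasDerivAt_momentum (hκ : 0 < κ) (hc : 2 * κ < c) :
    HasDerivAt (fun c => -(κ ^ 2 / 9) * limitAngle κ c +
        √(c ^ 2 - 2 * c * κ) * (c ^ 2 / (2 * (3 * c + 2 * κ)) - κ / 6))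
      (3 * c * (c + κ) / (3 * c + 2 * κ) ^ 2 * √(c ^ 2 - 2 * c * κ)) c := by
  have hD : 3 * c + 2 * κ ≠ 0 := by intro; linarith
  have hs := sqrt_pos.mpr (radicand_pos hκ hc)
  have h5 : √(c ^ 2 - 2 * c * κ) ^ 2 = c ^ 2 - 2 * c * κ := sq_sqrt (radicand_pos hκ hc).le
  have h1 : HasDerivAt (fun c : ℝ => c ^ 2 / (2 * (3 * c + 2 * κ)) - κ / 6)
      ((3 * c ^ 2 + 4 * κ * c) / (2 * (3 * c + 2 * κ) ^ 2)) c := by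
    refine ((((hasDerivAt_id c).pow 2).div
      ((((hasDerivAt_id c).const_mul 3).add_const (2 * κ)).const_mul 2)
      (mul_ne_zero two_ne_zero hD)).sub_const (κ / 6)).congr_deriv ?_
    simp only [id_eq, Pi.pow_apply]
    field_simp
    ring
  refine (((hasDerivAt_limitAngle hκ hc).const_mul (-(κ ^ 2 / 9))).add
    ((hasDerivAt_sqrt_radicand hκ hc).mul h1)).congr_deriv ?_
  set s := √(c ^ 2 - 2 * c * κ)
  have hD' : 3 * c + κ * 2 ≠ 0 := by rwa [mul_comm κ 2]
  field_simp
  rw [h5]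
  ring

theorem hasDerivAt_hamiltonian (hκ : 0 < κ) (hc : 2 * κ < c) :
    HasDerivAt (fun c => 10 * κ ^ 3 / 81 * limitAngle κ c - √(c ^ 2 - 2 * c * κ) *
        ((c ^ 3 - κ * c ^ 2 / 3) / (3 * (3 * c + 2 * κ)) - 5 * κ ^ 2 / 27))
      (-(3 * c ^ 2 * (c + κ) / (3 * c + 2 * κ) ^ 2) * √(c ^ 2 - 2 * c * κ)) c := by
  have hD : 3 * c + 2 * κ ≠ 0 := by intro; linarith
  have hs := sqrt_pos.mpr (radicand_pos hκ hc)
  have h5 : √(c ^ 2 - 2 * c * κ) ^ 2 = c ^ 2 - 2 * c * κ := sq_sqrt (radicand_pos hκ hc).le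
  have h1 : HasDerivAt (fun c : ℝ => (c ^ 3 - κ * c ^ 2 / 3) / (3 * (3 * c + 2 * κ)) -
      5 * κ ^ 2 / 27) (((3 * c ^ 2 - 2 * κ * c / 3) * (3 * c + 2 * κ) - 3 * (c ^ 3 - κ * c ^ 2 / 3))
        / (3 * (3 * c + 2 * κ) ^ 2)) c := by
    refine (((((hasDerivAt_id c).pow 3).sub ((((hasDerivAt_id c).pow 2).const_mul κ).div_const
      3)).div ((((hasDerivAt_id c).const_mul 3).add_const (2 * κ)).const_mul 3)
      (mul_ne_zero three_ne_zero hD)).sub_const (5 * κ ^ 2 / 27)).congr_deriv ?_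
    simp only [id_eq, Pi.pow_apply, Pi.sub_apply]
    field_simp
    ring
  refine (((hasDerivAt_limitAngle hκ hc).const_mul (10 * κ ^ 3 / 81)).sub
    ((hasDerivAt_sqrt_radicand hκ hc).mul h1)).congr_deriv ?_
  set s := √(c ^ 2 - 2 * c * κ)
  have hD' : 3 * c + κ * 2 ≠ 0 := by rwa [mul_comm κ 2]
  field_simp
  rw [h5]
  ring

end DegasperisProcesi

end

theorem mainTheorem7 (κ : ℝ) (hκ : 0 < κ) (φ : ℝ → ℝ → ℝ)
    (hφ : ∀ c : ℝ, 2 * κ < c → DegasperisProcesi.IsSmoothSolitaryWave κ c (φ c))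
    (c : ℝ) (hc : 2 * κ < c) :
    (MemLp (φ c) 2 volume ∧ Integrable (fun x => φ c x ^ 3) volume) ∧
    DifferentiableAt ℝ (fun b => DegasperisProcesi.H κ (φ b)) c ∧
    DifferentiableAt ℝ (fun b => DegasperisProcesi.S (φ b)) c ∧
    deriv (fun b => DegasperisProcesi.H κ (φ b)) c =
      -c * deriv (fun b => DegasperisProcesi.S (φ b)) c ∧
    -c * deriv (fun b => DegasperisProcesi.S (φ b)) c =
      -(3 * c ^ 2 * (c + κ) / (3 * c + 2 * κ) ^ 2) * √(c ^ 2 - 2 * c * κ) ∧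
    -(3 * c ^ 2 * (c + κ) / (3 * c + 2 * κ) ^ 2) * √(c ^ 2 - 2 * c * κ) < 0 := by
  -- The closed forms hold only for speeds above 2κ, an open condition, so they agree with `H` and
  -- `S` near c and can be differentiated there.
  have hev : ∀ᶠ b in 𝓝 c, 2 * κ < b := lt_mem_nhds hc
  have hH := (DegasperisProcesi.hasDerivAt_hamiltonian hκ hc).congr_of_eventuallyEq
    (f₁ := fun b => DegasperisProcesi.H κ (φ b)) (hev.mono fun b hb =>
      ((hφ b hb).memLp_and_energies hκ hb).2.2.trans
        (DegasperisProcesi.hamiltonian_closed_form hκ hb))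
  have hS := (DegasperisProcesi.hasDerivAt_momentum hκ hc).congr_of_eventuallyEq
    (f₁ := fun b => DegasperisProcesi.S (φ b)) (hev.mono fun b hb =>
      ((hφ b hb).memLp_and_energies hκ hb).2.1.trans
        (DegasperisProcesi.momentum_closed_form hκ hb))
  refine ⟨((hφ c hc).memLp_and_energies hκ hc).1, hH.differentiableAt, hS.differentiableAt,
    ?_, ?_, ?_⟩
  · rw [hH.deriv, hS.deriv]
    ring
  · rw [hS.deriv]
    ring
  · have hs := sqrt_pos.mpr (DegasperisProcesi.radicand_pos hκ hc)
    have hc0 : 0 < c := by linarith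
    rw [neg_mul, neg_lt_zero]
    positivity
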